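/- Let $(\Omega,\mathcal F,\mathbb P)$ be a probability space and let $\theta:\Omega\to\Omega$ be an invertible (with measurable inverse), measure-preserving and ergodic transformation. Let $\mathbb M_d$ be the $d\times d$ complex matrices, ordered by $A\le B$ iff $B-A$ is positive semidefinite. A quantum channel is a completely positive, trace-preserving linear map $\mathbb M_d\to\mathbb M_d$. Let $\omega\mapsto\phi_\omega$ be a measurable map from $\Omega$ to the quantum channels, and put $\phi_{n;\omega}=\phi_{\theta^n(\omega)}$ and $\Phi_N=\phi_N\circ\cdots\circ\phi_1$ for $N\ge 1$. Let $\mathbb M_d(\Omega)$ be the space of random matrices (measurable maps $\Omega\to\mathbb M_d$) modulo almost sure equality, ordered by $X\le Y$ iff $X_\omega\le Y_\omega$ almost surely, and let $\mathfrak L:\mathbb M_d(\Omega)\to\mathbb M_d(\Omega)$ be the operator $$\mathfrak L(X)_\omega=\phi_\omega\bigl(X_{\theta^{-1}(\omega)}\bigr),\qquad \operatorname{Fix}(\mathfrak L)=\{X\in\mathbb M_d(\Omega):\mathfrak L(X)=X\}.$$ A random projection is $P\in\mathbb M_d(\Omega)$ with $P=P^2=P^*$ almost surely. It is reducing if there is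 a random constant $C>0$ such that for all $N\ge 1$, $\Phi_N(P)\le C\,(P\circ\theta^N)$ almost surely. A minimal reducing projection is a minimal element of the set of all reducing random projections that are nonzero (that is, not almost surely equal to $0$). Write $P\,\mathbb M_d(\Omega)P=\{X\in\mathbb M_d(\Omega):PXP=X\text{ almost surely}\}$. A random state is $\rho\in\mathbb M_d(\Omega)$ with $\rho\ge 0$ and $\operatorname{Tr}\rho=1$ almost surely. Let $P$ be a minimal reducing projection. Then there is a random state $\rho_{\mathrm{eq}}\in P\,\mathbb M_d(\Omega)P$, with $\mathbb E\operatorname{Tr}|\rho_{\mathrm{eq}}|<\infty$, such that for almost every $\omega$ the orthogonal projection onto the range of $\rho_{\mathrm{eq};\omega}$ is $P_\omega$, and $$P\,\mathbb M_d(\Omega)P\cap\operatorname{Fix}(\mathfrak L)=\mathbb C\,\rho_{\mathrm{eq}}.$$ -/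

import Mathlib

open MeasureTheory
open scoped ComplexOrder MatrixOrder

namespace ERIS

/-- The `d × d` complex matrices; `≤` is the Loewner order (`A ≤ B` iff `B - A` is positive
semidefinite). -/
abbrev Mat (d : ℕ) : Type := Matrix (Fin d) (Fin d) ℂ

section Deterministic

variable {d : ℕ}

open scoped Matrix.Norms.L2Operator CStarAlgebra in
/-- Complete positivity of a linear map on the C*-algebra of `d × d` matrices. -/
def IsCompletelyPositive (ψ : Mat d →ₗ[ℂ] Mat d) : Prop :=
  ∃ f : Mat d →CP Mat d, f.toLinearMap = ψ

/-- Quantum channels: completely positive and trace-preserving linear maps. -/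
structure IsQuantumChannel (ψ : Mat d →ₗ[ℂ] Mat d) : Prop where
  completelyPositive : IsCompletelyPositive ψ
  trace_map : ∀ X : Mat d, (ψ X).trace = X.trace

/-- States (density matrices). -/
structure IsState (ρ : Mat d) : Prop where
  posSemidef : ρ.PosSemidef
  trace_eq_one : ρ.trace = 1

/-- The matrix of the orthogonal projection of `ℂ^d` onto the range of `A`. -/
noncomputable def rangeProj (A : Mat d) : Mat d :=
  Matrix.toEuclideanLin.symm
    ((LinearMap.range (Matrix.toEuclideanLin A)).starProjection :
      EuclideanSpace ℂ (Fin d) →ₗ[ℂ] EuclideanSpace ℂ (Fin d))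

/-- The trace norm `tr |A|`: the sum of the square roots of the eigenvalues of `A* A`. -/
noncomputable def traceNorm (A : Mat d) : ℝ :=
  ∑ i, √((Matrix.isHermitian_conjTranspose_mul_self A).eigenvalues i)

end Deterministic

/-- Random `d × d` matrices modulo almost sure equality. The order on it is the almost sure
Loewner order. -/
abbrev RandomMatrix {Ω : Type*} [MeasurableSpace Ω] (μ : Measure Ω) (d : ℕ) : Type _ :=
  Ω →ₘ[μ] Mat d

section RandomMatrices

variable {Ω : Type*} [MeasurableSpace Ω] {μ : Measure Ω} {d : ℕ}

/-- Random orthogonal projections: `P = P² = P*` almost surely. -/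
def IsRandomProjection (P : RandomMatrix μ d) : Prop :=
  ∀ᵐ ω ∂μ, IsStarProjection (P ω)

/-- Random states. -/
def IsRandomState (ρ : RandomMatrix μ d) : Prop :=
  ∀ᵐ ω ∂μ, IsState (ρ ω)

/-- The corner `P 𝕄_d(Ω) P`: the random matrices `X` with `P X P = X` almost surely. -/
def corner (P : RandomMatrix μ d) : Set (RandomMatrix μ d) :=
  {X | P * X * P = X}

/-- The corner `P 𝔄_* P`: the elements of `P 𝕄_d(Ω) P` with integrable trace norm. -/
def cornerL1 (P : RandomMatrix μ d) : Set (RandomMatrix μ d) :=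
  {X | X ∈ corner P ∧ ∫⁻ ω, ENNReal.ofReal (traceNorm (X ω)) ∂μ < ⊤}

end RandomMatrices

end ERIS

/-- An ergodic repeated interaction quantum system over `(Ω, μ)`: an invertible, ergodic,
measure-preserving `shift` (written `θ`) and a measurable random quantum channel
`channel` (written `φ`). The `n`-th channel is `φ_n = φ ∘ θ^n`. -/
structure ERIS {Ω : Type*} [MeasurableSpace Ω] (μ : Measure Ω) (d : ℕ) where
  shift : Ω ≃ᵐ Ω
  ergodic : Ergodic shift μ
  channel : Ω → (ERIS.Mat d →ₗ[ℂ] ERIS.Mat d)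
  stronglyMeasurable_channel : ∀ A : ERIS.Mat d, StronglyMeasurable fun ω => channel ω A
  isQuantumChannel : ∀ ω, ERIS.IsQuantumChannel (channel ω)

namespace ERIS

variable {Ω : Type*} [MeasurableSpace Ω] {μ : Measure Ω} {d : ℕ}

/-- For `N ≥ 1`, the map `Φ_N = φ_N ∘ ⋯ ∘ φ_1` at `ω`, where `φ_n` at `ω` is the channel at
`θ^n ω`. (At `N = 0` the recursion starts from the identity.) -/
def forward (Q : ERIS μ d) : ℕ → Ω → (Mat d →ₗ[ℂ] Mat d)
  | 0, _ => LinearMap.id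
  | N + 1, ω => Q.channel (Q.shift^[N + 1] ω) ∘ₗ Q.forward N ω

/-- The random projection `P` reduces the system: for some random constant `C > 0`,
`Φ_N(P) ≤ C (P ∘ θ^N)` almost surely for all `N ≥ 1`. -/
def Reduces (Q : ERIS μ d) (P : RandomMatrix μ d) : Prop :=
  IsRandomProjection P ∧
    ∃ C : Ω → ℝ, Measurable C ∧ (∀ ω, 0 < C ω) ∧
      ∀ N : ℕ, 1 ≤ N → ∀ᵐ ω ∂μ, Q.forward N ω (P ω) ≤ C ω • P (Q.shift^[N] ω)

/-- Minimal reducing projections: the minimal elements, for the almost sure Loewner order, of the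
set of nonzero reducing projections. -/
def IsMinimalReducing (Q : ERIS μ d) (P : RandomMatrix μ d) : Prop :=
  Minimal (fun R : RandomMatrix μ d => Q.Reduces R ∧ R ≠ 0) P

theorem measurePreserving_symm (Q : ERIS μ d) : MeasurePreserving Q.shift.symm μ μ :=
  Q.ergodic.toMeasurePreserving.symm Q.shift

theorem aestronglyMeasurable_channel_apply (Q : ERIS μ d) {Y : Ω → Mat d}
    (hY : AEStronglyMeasurable Y μ) :
    AEStronglyMeasurable (fun ω => Q.channel ω (Y ω)) μ := by
  have h : (fun ω => Q.channel ω (Y ω)) =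
      fun ω => ∑ i, ∑ j, Y ω i j • Q.channel ω (Matrix.single i j (1 : ℂ)) := by
    funext ω
    conv_lhs => rw [Matrix.matrix_eq_sum_single (Y ω)]
    simp only [map_sum]
    refine Finset.sum_congr rfl fun i _ => Finset.sum_congr rfl fun j _ => ?_
    rw [← map_smul, Matrix.smul_single, smul_eq_mul, mul_one]
  rw [h]
  refine Finset.aestronglyMeasurable_fun_sum _ fun i _ =>
    Finset.aestronglyMeasurable_fun_sum _ fun j _ => ?_
  have hij : AEStronglyMeasurable (fun ω => Y ω i j) μ :=
    (continuous_id.matrix_elem i j).comp_aestronglyMeasurable hY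
  exact hij.smul (Q.stronglyMeasurable_channel _).aestronglyMeasurable

/-- The operator `𝔏` on random matrices, `𝔏(X)_ω = φ_ω (X_{θ⁻¹ ω})`. -/
noncomputable def opL (Q : ERIS μ d) (X : RandomMatrix μ d) : RandomMatrix μ d :=
  AEEqFun.mk (fun ω => Q.channel ω (X (Q.shift.symm ω)))
    (Q.aestronglyMeasurable_channel_apply
      (X.aestronglyMeasurable.comp_measurePreserving Q.measurePreserving_symm))

/-- The fixed points of `𝔏` among all random matrices. -/
def fixedPoints (Q : ERIS μ d) : Set (RandomMatrix μ d) :=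
  {X | Q.opL X = X}

end ERIS

/-! Existence. Normalise `P` to a random state. Its orbit under `𝔏` stays in the corner because `P`
reduces, and its Cesàro averages are fixed up to `1/(N+1)`. The random states in the corner that are
fixed up to `1/(n+1)` form decreasing nonempty bounded closed convex sets in a Hilbert space `L²`,
so they have a common point: a fixed random state (`exists_stationary_state`).

Support. The range projection of a nonzero positive fixed point in the corner is again reducing,
nonzero and below `P`, so minimality makes it `P` (`rangeProj_eq_of_isMinimalReducing`).

Uniqueness. For a Hermitian fixed point `X` in the corner, ergodicity makes each inequality `X ≤ qρ`
hold almost surely or fail almost surely. Let `c` be the least `q` for which it holds. Then `cρ - X`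
is a positive fixed point. If it were nonzero, it would have full support `P` and would dominate a
positive multiple of `ρ` at some `ω`, against the choice of `c`. So `X = cρ`
(`exists_real_of_hermitian`), and real and imaginary parts give the complex case. -/

namespace ERIS

open Filter Topology

/-! ### Matrices: supports, Loewner bounds, states and channels -/

section Deterministic

variable {d : ℕ}

instance : TopologicalSpace.MetrizableSpace (Mat d) :=
  inferInstanceAs (TopologicalSpace.MetrizableSpace (Fin d → Fin d → ℂ))

instance : OrderClosedTopology (Mat d) := by
  open scoped Matrix.Norms.L2Operator in
  exact (inferInstance : OrderClosedTopology (Mat d))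

/-- The two equations give the two inclusions between the ranges of `A` and `R`, and an orthogonal
projection is determined by its range. -/
theorem rangeProj_eq {A R M : Mat d} (hR : IsStarProjection R) (hRA : R * A = A)
    (hRM : R = A * M) : rangeProj A = R := by
  have hrange : LinearMap.range (Matrix.toEuclideanLin A) =
      LinearMap.range (Matrix.toEuclideanLin R) := by
    apply le_antisymm
    · rintro _ ⟨v, rfl⟩
      refine ⟨Matrix.toEuclideanLin A v, ?_⟩
      conv_rhs => rw [← hRA]
      simp [Matrix.toLpLin_apply]
    · rintro _ ⟨v, rfl⟩
      refine ⟨Matrix.toEuclideanLin M v, ?_⟩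
      rw [hRM]
      simp [Matrix.toLpLin_apply]
  have hsp : IsStarProjection (Matrix.toEuclideanCLM (n := Fin d) (𝕜 := ℂ) R) :=
    hR.map Matrix.toEuclideanCLM
  have hcongr : ∀ (W W' : Submodule ℂ (EuclideanSpace ℂ (Fin d))) [W.HasOrthogonalProjection]
      [W'.HasOrthogonalProjection], W = W' → W.starProjection = W'.starProjection := by
    rintro W _ _ _ rfl
    rfl
  obtain ⟨_, h⟩ := isStarProjection_iff_eq_starProjection_range.mp hsp
  unfold rangeProj
  rw [LinearEquiv.symm_apply_eq]
  refine Eq.trans ?_ (Matrix.coe_toEuclideanCLM_eq_toEuclideanLin R)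
  exact congrArg ContinuousLinearMap.toLinearMap ((hcongr _ _ hrange).trans h.symm)

theorem map_conjStarAlgAut_nonneg (U : unitary (Mat d)) {D : Mat d} (hD : 0 ≤ D) :
    0 ≤ Unitary.conjStarAlgAut ℂ (Mat d) U D := by
  rw [Unitary.conjStarAlgAut_apply]
  rw [Matrix.nonneg_iff_posSemidef] at *
  exact hD.mul_mul_conjTranspose_same _

/-- All of this is read off the eigenvalues after diagonalising. The limit formula is what later
makes the support measurable in `ω`. -/
theorem exists_support {A : Mat d} (hA : 0 ≤ A) : ∃ R M : Mat d, ∃ K : ℝ, 0 ≤ K ∧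
    IsStarProjection R ∧ R * A = A ∧ R = A * M ∧ R ≤ K • A ∧
    Tendsto (fun n : ℕ => 1 - (1 - (1 + A.trace.re)⁻¹ • A) ^ n) atTop (𝓝 R) := by
  have hA' := Matrix.nonneg_iff_posSemidef.mp hA
  set l := hA'.1.eigenvalues with hl
  have hl0 : ∀ i, 0 ≤ l i := hA'.eigenvalues_nonneg
  have htr : A.trace.re = ∑ i, l i := by
    rw [hA'.1.trace_eq_sum_eigenvalues]
    simp [hl]
  have hle : ∀ i, l i ≤ A.trace.re := fun i => by
    rw [htr]; exact Finset.single_le_sum (fun j _ => hl0 j) (Finset.mem_univ i)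
  set F := Unitary.conjStarAlgAut ℂ (Mat d) hA'.1.eigenvectorUnitary with hF
  have hAF : A = F (Matrix.diagonal fun i => (l i : ℂ)) := hA'.1.spectral_theorem
  set e : Fin d → ℂ := fun i => if l i = 0 then 0 else 1 with he
  -- Since `0⁻¹ = 0`, the second matrix is the pseudo-inverse of `A`, and zero eigenvalues
  -- contribute nothing to the constant.
  refine ⟨F (Matrix.diagonal e), F (Matrix.diagonal fun i => ((l i)⁻¹ : ℂ)), ∑ i, (l i)⁻¹,
    Finset.sum_nonneg fun i _ => inv_nonneg.mpr (hl0 i), ?_, ?_, ?_, ?_, ?_⟩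
  · refine IsStarProjection.map ⟨?_, ?_⟩ F
    · unfold IsIdempotentElem
      rw [Matrix.diagonal_mul_diagonal]
      congr 1; ext i; simp only [he]; split_ifs <;> simp
    · unfold IsSelfAdjoint
      rw [Matrix.star_eq_conjTranspose, Matrix.diagonal_conjTranspose]
      congr 1; ext i; simp only [he, Pi.star_apply]; split_ifs <;> simp
  · rw [hAF, ← map_mul, Matrix.diagonal_mul_diagonal]
    congr 2; ext i; simp only [he]; split_ifs with h <;> simp [h]
  · conv_rhs => rw [hAF]
    rw [← map_mul, Matrix.diagonal_mul_diagonal]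
    congr 2; ext i; simp only [he]; split_ifs with h <;> simp [h]
  · rw [← sub_nonneg]
    have : (∑ i, (l i)⁻¹) • A - F (Matrix.diagonal e) =
        F (Matrix.diagonal fun i => ((((∑ i, (l i)⁻¹) * l i : ℝ) : ℂ) - e i)) := by
      conv_lhs => rw [hAF]
      rw [← Complex.coe_smul, ← map_smul, ← map_sub]
      congr 1
      ext i j
      by_cases hij : i = j
      · subst hij; simp
      · simp [hij]
    rw [this]
    apply map_conjStarAlgAut_nonneg
    rw [Matrix.nonneg_iff_posSemidef]
    apply Matrix.PosSemidef.diagonal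
    intro i
    simp only [he, Pi.zero_apply, sub_nonneg]
    split_ifs with h
    · simp [h]
    · have : (1 : ℝ) ≤ (∑ i, (l i)⁻¹) * l i := by
        have h1 : (l i)⁻¹ ≤ ∑ i, (l i)⁻¹ :=
          Finset.single_le_sum (f := fun i => (l i)⁻¹)
            (fun j _ => inv_nonneg.mpr (hl0 j)) (Finset.mem_univ i)
        calc (1 : ℝ) = (l i)⁻¹ * l i := (inv_mul_cancel₀ h).symm
          _ ≤ _ := mul_le_mul_of_nonneg_right h1 (hl0 i)
      exact_mod_cast this
  -- Dividing by `1 + tr A` puts every eigenvalue in `[0, 1)`, so `(1 - c l)ⁿ` tends to `0` if `l ≠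
  -- 0` and is constantly `1` if `l = 0`.
  · set c := (1 + A.trace.re)⁻¹ with hc
    have hpos : 0 < 1 + A.trace.re := by
      have : 0 ≤ A.trace.re := by rw [htr]; exact Finset.sum_nonneg fun i _ => hl0 i
      linarith
    have hfun : ∀ n : ℕ, 1 - (1 - c • A) ^ n =
        F (Matrix.diagonal fun i => 1 - (1 - ((c * l i : ℝ) : ℂ)) ^ n) := by
      intro n
      have h1 : 1 - c • A = F (Matrix.diagonal fun i => 1 - ((c * l i : ℝ) : ℂ)) := by
        conv_lhs => rw [hAF]
        rw [← Complex.coe_smul, ← map_smul, ← map_one F, ← map_sub]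
        congr 1
        ext i j
        by_cases hij : i = j
        · subst hij; simp
        · simp [hij]
      rw [h1, ← map_pow, Matrix.diagonal_pow, ← map_one F, ← map_sub]
      congr 1
      ext i j
      by_cases hij : i = j
      · subst hij; simp
      · simp [hij]
    simp_rw [hfun]
    have hFc : Continuous fun X : Mat d => F X := by
      simp only [hF, Unitary.conjStarAlgAut_apply]
      fun_prop
    refine (hFc.tendsto _).comp ?_
    refine ((continuous_id.matrix_diagonal).tendsto e).comp ?_
    rw [tendsto_pi_nhds]
    intro i
    simp only [he]
    split_ifs with h
    · simp [h]
    · have hli : 0 < l i := lt_of_le_of_ne (hl0 i) (Ne.symm h)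
      have hcpos : 0 < c := inv_pos.mpr hpos
      have h1 : c * l i ≤ 1 := by
        rw [hc, inv_mul_le_iff₀ hpos]; linarith [hle i]
      have h2 : 0 < c * l i := mul_pos hcpos hli
      have h3 : Tendsto (fun n : ℕ => (1 - c * l i) ^ n) atTop (𝓝 0) :=
        tendsto_pow_atTop_nhds_zero_of_lt_one (by linarith) (by linarith)
      have h4 : Tendsto (fun n : ℕ => ((1 - (1 - c * l i) ^ n : ℝ) : ℂ)) atTop
          (𝓝 ((1 - 0 : ℝ) : ℂ)) :=
        (Complex.continuous_ofReal.tendsto _).comp (tendsto_const_nhds.sub h3)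
      simpa using h4

theorem rangeProj_spec {A : Mat d} (hA : 0 ≤ A) : IsStarProjection (rangeProj A) ∧
    rangeProj A * A = A ∧ (∃ M, rangeProj A = A * M) ∧ (∃ K : ℝ, 0 ≤ K ∧ rangeProj A ≤ K • A) ∧
    Tendsto (fun n : ℕ => 1 - (1 - (1 + A.trace.re)⁻¹ • A) ^ n) atTop (𝓝 (rangeProj A)) := by
  obtain ⟨R, M, K, hK, h1, h2, h3, h4, h5⟩ := exists_support hA
  rw [rangeProj_eq h1 h2 h3]
  exact ⟨h1, h2, ⟨M, h3⟩, ⟨K, hK, h4⟩, h5⟩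

theorem exists_le_smul_one {B : Mat d} (hB : B.IsHermitian) : ∃ K : ℝ, 0 ≤ K ∧ B ≤ K • 1 := by
  open scoped Matrix.Norms.L2Operator in
  refine ⟨‖B‖, norm_nonneg _, ?_⟩
  have := IsSelfAdjoint.le_algebraMap_norm_self (a := B) (ha := hB)
  rwa [Algebra.algebraMap_eq_smul_one] at this

theorem conj_le_conj_of_projection {R A B : Mat d} (hR : IsStarProjection R) (h : A ≤ B) :
    R * A * R ≤ R * B * R := by
  have := star_left_conjugate_le_conjugate h R
  rwa [hR.isSelfAdjoint.star_eq] at this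

theorem le_smul_projection {R B : Mat d} {K : ℝ} (hR : IsStarProjection R) (hB : R * B * R = B)
    (h : B ≤ K • 1) : B ≤ K • R := by
  have := conj_le_conj_of_projection hR h
  rw [hB, mul_smul_comm, mul_one, smul_mul_assoc, hR.isIdempotentElem.eq] at this
  exact this

theorem le_trace_smul_one {A : Mat d} (hA : 0 ≤ A) : A ≤ A.trace.re • 1 := by
  have hA' := Matrix.nonneg_iff_posSemidef.mp hA
  set l := hA'.1.eigenvalues with hl
  have hl0 : ∀ i, 0 ≤ l i := hA'.eigenvalues_nonneg
  have htr : A.trace.re = ∑ i, l i := by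
    rw [hA'.1.trace_eq_sum_eigenvalues]
    simp [hl]
  have hle : ∀ i, l i ≤ A.trace.re := fun i => by
    rw [htr]; exact Finset.single_le_sum (fun j _ => hl0 j) (Finset.mem_univ i)
  set F := Unitary.conjStarAlgAut ℂ (Mat d) hA'.1.eigenvectorUnitary with hF
  have hAF : A = F (Matrix.diagonal fun i => (l i : ℂ)) := hA'.1.spectral_theorem
  rw [← sub_nonneg]
  have : A.trace.re • 1 - A = F (Matrix.diagonal fun i => ((A.trace.re - l i : ℝ) : ℂ)) := by
    conv_lhs => rw [← map_one F, ← Complex.coe_smul, ← map_smul]; arg 2; rw [hAF]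
    rw [← map_sub]
    congr 1
    ext i j
    by_cases hij : i = j
    · subst hij; simp
    · simp [hij]
  rw [this]
  apply map_conjStarAlgAut_nonneg
  rw [Matrix.nonneg_iff_posSemidef]
  apply Matrix.PosSemidef.diagonal
  intro i
  have := hle i
  simp only [Pi.zero_apply]
  exact_mod_cast sub_nonneg.mpr this

/-- A Hermitian matrix supported in the range of a positive semidefinite one is dominated by it. -/
theorem exists_le_smul {A B : Mat d} (hA : 0 ≤ A) (hB : B.IsHermitian)
    (h : rangeProj A * B * rangeProj A = B) : ∃ K : ℝ, 0 ≤ K ∧ B ≤ K • A := by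
  obtain ⟨hR, -, -, ⟨K, hK, hKA⟩, -⟩ := rangeProj_spec hA
  obtain ⟨K', hK', hB'⟩ := exists_le_smul_one hB
  refine ⟨K' * K, mul_nonneg hK' hK, (le_smul_projection hR h hB').trans ?_⟩
  rw [mul_smul]
  exact smul_le_smul_of_nonneg_left hKA hK'

/-- A positive semidefinite matrix below a multiple of a projection is supported in it. -/
theorem conj_eq_of_le {R A : Mat d} {K : ℝ} (hR : IsStarProjection R) (hA : 0 ≤ A)
    (h : A ≤ K • R) : R * A * R = A := by
  have h1 : (1 - R) * A * (1 - R) = 0 := by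
    apply le_antisymm
    · have := conj_le_conj_of_projection hR.one_sub h
      rwa [mul_smul_comm, hR.one_sub_mul_self, smul_zero, zero_mul] at this
    · simpa using conj_le_conj_of_projection hR.one_sub hA
  -- For `A ≥ 0`, a vector `v` with `⟨v, A v⟩ = 0` lies in the kernel; here `v` runs over the
  -- columns of `1 - R`.
  have h2 : A * (1 - R) = 0 := by
    have hA' := Matrix.nonneg_iff_posSemidef.mp hA
    ext i j
    have h3 := (hA'.dotProduct_mulVec_zero_iff ((1 - R).col j)).mp (by
      have h4 : (star (1 - R) * (A * (1 - R))) j j = 0 := by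
        rw [hR.one_sub.isSelfAdjoint.star_eq, ← mul_assoc, h1]; rfl
      rw [← h4, Matrix.mul_apply]
      simp only [dotProduct]
      rfl)
    have := congrFun h3 i
    simpa [Matrix.mulVec, Matrix.mul_apply, dotProduct] using this
  have h3 : A * R = A := by
    rw [mul_sub, mul_one, sub_eq_zero] at h2; exact h2.symm
  have h4 : R * A = A := by
    have := congrArg star h3
    have hs : star A = A := (Matrix.nonneg_iff_posSemidef.mp hA).1
    rwa [star_mul, hs, hR.isSelfAdjoint.star_eq] at this
  rw [h4, h3]

theorem trace_re_nonneg {A : Mat d} (hA : 0 ≤ A) : 0 ≤ A.trace.re :=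
  (Complex.nonneg_iff.mp (Matrix.nonneg_iff_posSemidef.mp hA).trace_nonneg).1

theorem trace_re_mono {A B : Mat d} (h : A ≤ B) : A.trace.re ≤ B.trace.re := by
  have := trace_re_nonneg (sub_nonneg.mpr h)
  simpa using this

theorem IsState.nonneg {ρ : Mat d} (h : IsState ρ) : 0 ≤ ρ :=
  Matrix.nonneg_iff_posSemidef.mpr h.posSemidef

theorem IsState.le_one {ρ : Mat d} (h : IsState ρ) : ρ ≤ 1 := by
  have := le_trace_smul_one h.nonneg
  simpa [h.trace_eq_one] using this

/-- It follows from `ρ² ≤ ρ`, as `ρ - ρ² = ρ(1 - ρ)ρ + (1 - ρ)ρ(1 - ρ)`. This bounds both the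
Hilbert–Schmidt norm and the trace norm of states. -/
theorem IsState.trace_conjTranspose_mul_self_le {ρ : Mat d} (h : IsState ρ) :
    (ρ.conjTranspose * ρ).trace.re ≤ 1 := by
  have hs : star ρ = ρ := h.posSemidef.1
  have h1 : 0 ≤ ρ * (1 - ρ) * ρ := by
    have := star_left_conjugate_nonneg (sub_nonneg.mpr h.le_one) ρ
    rwa [hs] at this
  have h2 : 0 ≤ (1 - ρ) * ρ * (1 - ρ) := by
    have := star_left_conjugate_nonneg h.nonneg (1 - ρ)
    rwa [star_sub, star_one, hs] at this
  have h3 : ρ * ρ ≤ ρ := by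
    rw [← sub_nonneg]
    have := add_nonneg h1 h2
    convert this using 1
    noncomm_ring
  have := trace_re_mono h3
  rw [h.trace_eq_one] at this
  rw [← Matrix.star_eq_conjTranspose, hs]
  simpa using this

theorem IsState.traceNorm_le {ρ : Mat d} (h : IsState ρ) : traceNorm ρ ≤ d := by
  have hle : ∀ i, (Matrix.isHermitian_conjTranspose_mul_self ρ).eigenvalues i ≤ 1 := by
    intro i
    refine le_trans ?_ h.trace_conjTranspose_mul_self_le
    rw [(Matrix.isHermitian_conjTranspose_mul_self ρ).trace_eq_sum_eigenvalues]
    rw [← RCLike.ofReal_sum]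
    simp only [Complex.coe_algebraMap, Complex.ofReal_re]
    exact Finset.single_le_sum
      (f := (Matrix.isHermitian_conjTranspose_mul_self ρ).eigenvalues)
      (fun j _ => Matrix.eigenvalues_conjTranspose_mul_self_nonneg ρ j)
      (Finset.mem_univ i)
  unfold traceNorm
  calc _ ≤ ∑ _i : Fin d, (1 : ℝ) := Finset.sum_le_sum fun i _ => by
        exact (Real.sqrt_le_sqrt (hle i)).trans_eq Real.sqrt_one
    _ = d := by simp

theorem IsQuantumChannel.map_nonneg {ψ : Mat d →ₗ[ℂ] Mat d} (h : IsQuantumChannel ψ) {A : Mat d}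
    (hA : 0 ≤ A) : 0 ≤ ψ A := by
  obtain ⟨f, rfl⟩ := h.completelyPositive
  open scoped Matrix.Norms.L2Operator CStarAlgebra in
  exact _root_.map_nonneg f hA

theorem IsQuantumChannel.mono {ψ : Mat d →ₗ[ℂ] Mat d} (h : IsQuantumChannel ψ) {A B : Mat d}
    (hA : A ≤ B) : ψ A ≤ ψ B := by
  rw [← sub_nonneg, ← map_sub]
  exact h.map_nonneg (sub_nonneg.mpr hA)

theorem IsQuantumChannel.map_conjTranspose {ψ : Mat d →ₗ[ℂ] Mat d} (h : IsQuantumChannel ψ)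
    (A : Mat d) : ψ A.conjTranspose = (ψ A).conjTranspose := by
  obtain ⟨f, rfl⟩ := h.completelyPositive
  open scoped Matrix.Norms.L2Operator CStarAlgebra in
  exact map_star f A

theorem IsQuantumChannel.isState {ψ : Mat d →ₗ[ℂ] Mat d} (h : IsQuantumChannel ψ) {A : Mat d}
    (hA : IsState A) : IsState (ψ A) :=
  ⟨Matrix.nonneg_iff_posSemidef.mp (h.map_nonneg hA.nonneg), by rw [h.trace_map, hA.trace_eq_one]⟩

theorem channel_map_real_smul (ψ : Mat d →ₗ[ℂ] Mat d) (c : ℝ) (A : Mat d) :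
    ψ (c • A) = c • ψ A := by
  rw [← Complex.coe_smul, map_smul, Complex.coe_smul]

/-- A positive map that sends a projection under a multiple of another one
sends the corresponding corners into each other. -/
theorem IsQuantumChannel.map_corner {ψ : Mat d →ₗ[ℂ] Mat d} (h : IsQuantumChannel ψ)
    {R S A : Mat d} {K : ℝ} (hR : IsStarProjection R) (hS : IsStarProjection S)
    (hRS : ψ R ≤ K • S) (hA : 0 ≤ A) (hRA : R * A * R = A) : S * ψ A * S = ψ A := by
  have h1 := h.mono (le_smul_projection hR hRA (le_trace_smul_one hA))
  rw [channel_map_real_smul] at h1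
  refine conj_eq_of_le (K := A.trace.re * K) hS (h.map_nonneg hA) (h1.trans ?_)
  rw [mul_smul]
  exact smul_le_smul_of_nonneg_left hRS (trace_re_nonneg hA)

end Deterministic

/-! ### Almost sure statements: ergodicity, fixed points, one-step reduction -/

section Stochastic

variable {Ω : Type*} [MeasurableSpace Ω] {μ : Measure Ω} {d : ℕ}

theorem ae_shift (Q : ERIS μ d) {p : Ω → Prop} (h : ∀ᵐ ω ∂μ, p ω) :
    ∀ᵐ ω ∂μ, p (Q.shift ω) :=
  Q.ergodic.toMeasurePreserving.quasiMeasurePreserving.ae h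

theorem ae_shift_symm (Q : ERIS μ d) {p : Ω → Prop} (h : ∀ᵐ ω ∂μ, p ω) :
    ∀ᵐ ω ∂μ, p (Q.shift.symm ω) :=
  Q.measurePreserving_symm.quasiMeasurePreserving.ae h

theorem ae_shift_iterate (Q : ERIS μ d) (N : ℕ) {p : Ω → Prop} (h : ∀ᵐ ω ∂μ, p ω) :
    ∀ᵐ ω ∂μ, p (Q.shift^[N] ω) :=
  (Q.ergodic.toMeasurePreserving.iterate N).quasiMeasurePreserving.ae h

/-- A property that is stable under the shift holds almost surely or fails almost surely. -/
theorem ae_or_ae_not [IsFiniteMeasure μ] (Q : ERIS μ d) {p : Ω → Prop}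
    (hp : NullMeasurableSet {ω | p ω} μ) (h : ∀ᵐ ω ∂μ, p ω → p (Q.shift ω)) :
    (∀ᵐ ω ∂μ, p ω) ∨ ∀ᵐ ω ∂μ, ¬ p ω := by
  -- One inclusion is enough: the set and its preimage have the same finite measure.
  have hle : {ω | p ω} ≤ᵐ[μ] Q.shift ⁻¹' {ω | p ω} := h
  rcases Q.ergodic.ae_empty_or_univ_of_ae_le_preimage hp hle with h | h
  · exact Or.inr (Filter.eventuallyEq_empty.mp h)
  · exact Or.inl (Filter.eventuallyEq_univ.mp h)

theorem coeFn_opL (Q : ERIS μ d) (X : RandomMatrix μ d) :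
    Q.opL X =ᵐ[μ] fun ω => Q.channel ω (X (Q.shift.symm ω)) :=
  AEEqFun.coeFn_mk _ _

/-- Replacing `ω` by `θω` removes the inverse shift. -/
theorem mem_fixedPoints_iff (Q : ERIS μ d) (X : RandomMatrix μ d) :
    X ∈ Q.fixedPoints ↔ ∀ᵐ ω ∂μ, Q.channel (Q.shift ω) (X ω) = X (Q.shift ω) := by
  have h1 : X ∈ Q.fixedPoints ↔ ∀ᵐ ω ∂μ, Q.channel ω (X (Q.shift.symm ω)) = X ω := by
    change Q.opL X = X ↔ _
    rw [AEEqFun.ext_iff]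
    constructor
    · intro h
      filter_upwards [h, Q.coeFn_opL X] with ω h1 h2
      rw [← h2, h1]
    · intro h
      filter_upwards [h, Q.coeFn_opL X] with ω h1 h2
      rw [h2, h1]
  rw [h1]
  constructor
  · intro h
    filter_upwards [Q.ae_shift h] with ω hω
    simpa using hω
  · intro h
    filter_upwards [Q.ae_shift_symm h] with ω hω
    simpa using hω

theorem mem_corner_iff (P X : RandomMatrix μ d) :
    X ∈ corner P ↔ ∀ᵐ ω ∂μ, P ω * X ω * P ω = X ω := by
  change P * X * P = X ↔ _
  have h : ⇑(P * X * P) =ᵐ[μ] fun ω => P ω * X ω * P ω := by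
    filter_upwards [AEEqFun.coeFn_mul (P * X) P, AEEqFun.coeFn_mul P X] with ω h1 h2
    rw [h1, Pi.mul_apply, h2, Pi.mul_apply]
  rw [AEEqFun.ext_iff]
  constructor
  · intro h'
    filter_upwards [h, h'] with ω h1 h2
    rw [← h1, h2]
  · intro h'
    filter_upwards [h, h'] with ω h1 h2
    rw [h1, h2]

theorem ne_zero_of_ae_ne_zero [NeZero μ] {X : RandomMatrix μ d} (h : ∀ᵐ ω ∂μ, X ω ≠ 0) :
    X ≠ 0 := by
  rintro rfl
  obtain ⟨ω, h1, h2⟩ := (h.and (AEEqFun.coeFn_zero (α := Ω) (β := Mat d) (μ := μ))).exists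
  exact h1 h2

theorem eq_zero_of_ae_eq_zero {X : RandomMatrix μ d} (h : ∀ᵐ ω ∂μ, X ω = 0) : X = 0 := by
  rw [AEEqFun.ext_iff]
  filter_upwards [h, AEEqFun.coeFn_zero (α := Ω) (β := Mat d) (μ := μ)] with ω h1 h2
  rw [h1, h2]; rfl

theorem forward_nonneg (Q : ERIS μ d) (N : ℕ) (ω : Ω) {A : Mat d} (hA : 0 ≤ A) :
    0 ≤ Q.forward N ω A := by
  induction N with
  | zero => exact hA
  | succ N ih => exact (Q.isQuantumChannel _).map_nonneg ih

theorem trace_forward (Q : ERIS μ d) (N : ℕ) (ω : Ω) (A : Mat d) :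
    (Q.forward N ω A).trace = A.trace := by
  induction N with
  | zero => rfl
  | succ N ih => exact ((Q.isQuantumChannel _).trace_map _).trans ih

/-- It suffices to check the reduction for a single step. -/
theorem reduces_of_step (Q : ERIS μ d) {R : RandomMatrix μ d} (hR : IsRandomProjection R)
    (h : ∀ᵐ ω ∂μ, ∃ K : ℝ, 0 ≤ K ∧ Q.channel (Q.shift ω) (R ω) ≤ K • R (Q.shift ω)) :
    Q.Reduces R := by
  -- The constant from iterating the one-step bound depends on `N`, but it places `Φ_N(R)` in the
  -- corner of `R ∘ θ^N`. There `Φ_N(R)` is at most its trace times the projection, and that trace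
  -- is `tr R ≤ d`. The `+ 1` keeps the constant positive when `d = 0`.
  refine ⟨hR, fun _ => (d : ℝ) + 1, measurable_const, fun _ => by positivity, fun N hN1 => ?_⟩
  clear hN1
  have hN : ∀ᵐ ω ∂μ, ∃ K : ℝ, 0 ≤ K ∧ Q.forward N ω (R ω) ≤ K • R (Q.shift^[N] ω) := by
    induction N with
    | zero => exact Eventually.of_forall fun ω => ⟨1, zero_le_one, by simp [forward]⟩
    | succ N ih =>
      filter_upwards [ih, Q.ae_shift_iterate N h] with ω ⟨K, hK, h1⟩ ⟨K', hK', h2⟩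
      refine ⟨K * K', mul_nonneg hK hK', ?_⟩
      have h3 := (Q.isQuantumChannel (Q.shift^[N + 1] ω)).mono h1
      rw [channel_map_real_smul] at h3
      refine h3.trans ?_
      rw [mul_smul, Function.iterate_succ_apply']
      exact smul_le_smul_of_nonneg_left h2 hK
  filter_upwards [hN, hR, Q.ae_shift_iterate N hR] with ω ⟨K, hK, h1⟩ h2 h3
  have h4 := Q.forward_nonneg N ω h2.nonneg
  refine le_smul_projection h3 (conj_eq_of_le h3 h4 h1) ((le_trace_smul_one h4).trans ?_)
  refine smul_le_smul_of_nonneg_right ?_ zero_le_one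
  rw [trace_forward]
  have := trace_re_mono h2.le_one
  simp only [Matrix.trace_one, Fintype.card_fin, Complex.natCast_re] at this
  linarith

theorem Reduces.step {Q : ERIS μ d} {R : RandomMatrix μ d} (hR : Q.Reduces R) :
    ∀ᵐ ω ∂μ, ∃ K : ℝ, 0 ≤ K ∧ Q.channel (Q.shift ω) (R ω) ≤ K • R (Q.shift ω) := by
  obtain ⟨-, C, -, hC, h⟩ := hR
  filter_upwards [h 1 le_rfl] with ω hω
  exact ⟨C ω, (hC ω).le, by simpa [forward] using hω⟩

end Stochastic

/-! ### Supports of fixed points and uniqueness -/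

section Stochastic

variable {Ω : Type*} [MeasurableSpace Ω] {μ : Measure Ω} {d : ℕ}

/-- The range projection is not continuous in the matrix, but it is a pointwise limit of continuous
functions of it. -/
theorem aestronglyMeasurable_rangeProj {Y : Ω → Mat d} (hY : AEStronglyMeasurable Y μ)
    (h0 : ∀ᵐ ω ∂μ, 0 ≤ Y ω) : AEStronglyMeasurable (fun ω => rangeProj (Y ω)) μ := by
  refine aestronglyMeasurable_of_tendsto_ae (u := atTop)
    (f := fun (n : ℕ) ω => 1 - (1 - (1 + (Y ω).trace.re)⁻¹ • Y ω) ^ n) (fun n => ?_) ?_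
  · have htr : AEStronglyMeasurable (fun ω => (1 + (Y ω).trace.re)⁻¹) μ := by
      have hc : Continuous fun A : Mat d => 1 + A.trace.re := by fun_prop
      exact (hc.comp_aestronglyMeasurable hY).inv₀
    have hc : Continuous fun A : Mat d => 1 - (1 - A) ^ n := by fun_prop
    exact hc.comp_aestronglyMeasurable (htr.smul hY)
  · filter_upwards [h0] with ω hω
    exact (rangeProj_spec hω).2.2.2.2

theorem ae_ne_zero_of_shift [IsFiniteMeasure μ] (Q : ERIS μ d) {Y : RandomMatrix μ d}
    (h : ∀ᵐ ω ∂μ, Y ω ≠ 0 → Y (Q.shift ω) ≠ 0) (hne : Y ≠ 0) : ∀ᵐ ω ∂μ, Y ω ≠ 0 := by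
  have hm : NullMeasurableSet {ω | Y ω ≠ 0} μ :=
    Y.aestronglyMeasurable.nullMeasurableSet_support
  refine (Q.ae_or_ae_not hm h).resolve_right fun h' => hne ?_
  exact eq_zero_of_ae_eq_zero (h'.mono fun ω hω => not_not.mp hω)

/-- If `R` vanished at `θω`, then `φ(R_ω) ≤ 0`; trace preservation would force `R_ω = 0`. Ergodicity
does the rest. -/
theorem Reduces.ae_ne_zero [IsFiniteMeasure μ] {Q : ERIS μ d} {R : RandomMatrix μ d}
    (hR : Q.Reduces R) (hne : R ≠ 0) : ∀ᵐ ω ∂μ, R ω ≠ 0 := by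
  refine Q.ae_ne_zero_of_shift ?_ hne
  filter_upwards [hR.step, hR.1] with ω ⟨K, hK, h1⟩ h2 hω h0
  rw [h0, smul_zero] at h1
  have h3 := (Q.isQuantumChannel (Q.shift ω)).map_nonneg h2.nonneg
  have h4 := (Q.isQuantumChannel (Q.shift ω)).trace_map (R ω)
  rw [le_antisymm h1 h3, Matrix.trace_zero] at h4
  exact hω ((Matrix.nonneg_iff_posSemidef.mp h2.nonneg).trace_eq_zero_iff.mp h4.symm)

/-- Every nonzero positive fixed point in the corner of a minimal reducing projection `P`
has support `P`. -/
theorem rangeProj_eq_of_isMinimalReducing {Q : ERIS μ d} {P : RandomMatrix μ d}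
    (hP : Q.IsMinimalReducing P) {Y : RandomMatrix μ d} (h0 : ∀ᵐ ω ∂μ, 0 ≤ Y ω)
    (hfix : Y ∈ Q.fixedPoints) (hcorner : Y ∈ corner P) (hne : Y ≠ 0) :
    ∀ᵐ ω ∂μ, rangeProj (Y ω) = P ω := by
  rw [mem_fixedPoints_iff] at hfix
  rw [mem_corner_iff] at hcorner
  set R : RandomMatrix μ d :=
    AEEqFun.mk _ (aestronglyMeasurable_rangeProj Y.aestronglyMeasurable h0) with hRdef
  have hR : ∀ᵐ ω ∂μ, R ω = rangeProj (Y ω) := AEEqFun.coeFn_mk _ _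
  have hRproj : IsRandomProjection R := by
    filter_upwards [hR, h0] with ω h1 h2
    rw [h1]
    exact (rangeProj_spec h2).1
  -- With `R` the support of `Y`: `R ≤ K Y`, the channel sends `Y` to `Y ∘ θ`, and `Y ∘ θ ≤ tr(Y ∘
  -- θ) (R ∘ θ)`.
  have hRred : Q.Reduces R := by
    refine Q.reduces_of_step hRproj ?_
    filter_upwards [hR, Q.ae_shift hR, h0, Q.ae_shift h0, hfix] with ω h1 h2 h3 h4 h5
    obtain ⟨-, -, -, ⟨K, hK, h6⟩, -⟩ := rangeProj_spec h3
    obtain ⟨hs, h7, -⟩ := rangeProj_spec h4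
    have hstar : star (Y (Q.shift ω)) = Y (Q.shift ω) :=
      (Matrix.nonneg_iff_posSemidef.mp h4).1
    have h8 : rangeProj (Y (Q.shift ω)) * Y (Q.shift ω) * rangeProj (Y (Q.shift ω)) =
        Y (Q.shift ω) := by
      have := congrArg star h7
      rw [star_mul, hstar, hs.isSelfAdjoint.star_eq] at this
      rw [h7, this]
    have h9 := le_smul_projection hs h8 (le_trace_smul_one h4)
    have h10 := (Q.isQuantumChannel (Q.shift ω)).mono h6
    rw [channel_map_real_smul, h5] at h10
    rw [h1, h2]
    refine ⟨K * (Y (Q.shift ω)).trace.re, mul_nonneg hK (trace_re_nonneg h4), h10.trans ?_⟩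
    rw [mul_smul]
    exact smul_le_smul_of_nonneg_left h9 hK
  have hRne : R ≠ 0 := by
    intro hR0
    refine hne (eq_zero_of_ae_eq_zero ?_)
    rw [hR0] at hR
    filter_upwards [hR, h0, AEEqFun.coeFn_zero (α := Ω) (β := Mat d) (μ := μ)] with ω h1 h2 h3
    rw [h3] at h1
    rw [← (rangeProj_spec h2).2.1, ← h1]
    exact zero_mul _
  have hRP : R ≤ P := by
    rw [← AEEqFun.coeFn_le]
    filter_upwards [hR, h0, hcorner, hP.prop.1.1] with ω h1 h2 h3 h4
    obtain ⟨hs, -, ⟨M, h5⟩, -, -⟩ := rangeProj_spec h2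
    rw [h1]
    have h6 : P ω * rangeProj (Y ω) = rangeProj (Y ω) := by
      rw [h5, ← h3]
      simp only [← mul_assoc, h4.isIdempotentElem.eq]
    have h7 : rangeProj (Y ω) * P ω = rangeProj (Y ω) := by
      have := congrArg star h6
      rwa [star_mul, hs.isSelfAdjoint.star_eq, h4.isSelfAdjoint.star_eq] at this
    have := conj_le_conj_of_projection h4 hs.le_one
    rwa [h6, h7, mul_one, h4.isIdempotentElem.eq] at this
  have hPR : P = R := le_antisymm (hP.le_of_le ⟨hRred, hRne⟩ hRP) hRP
  rw [hPR]
  exact hR.mono fun ω h => h.symm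

theorem exists_real_of_hermitian [IsProbabilityMeasure μ] {Q : ERIS μ d} {P : RandomMatrix μ d}
    (hP : Q.IsMinimalReducing P) {ρ : RandomMatrix μ d} (hρ : IsRandomState ρ)
    (hρfix : ρ ∈ Q.fixedPoints) (hρP : ∀ᵐ ω ∂μ, rangeProj (ρ ω) = P ω)
    {X : RandomMatrix μ d} (hX : ∀ᵐ ω ∂μ, (X ω).IsHermitian)
    (hfix : X ∈ Q.fixedPoints) (hcorner : X ∈ corner P) :
    ∃ c : ℝ, ∀ᵐ ω ∂μ, X ω = c • ρ ω := by
  have hρfix' := (mem_fixedPoints_iff Q ρ).mp hρfix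
  have hfix' := (mem_fixedPoints_iff Q X).mp hfix
  have hcorner' := (mem_corner_iff P X).mp hcorner
  have hρ0 : ∀ᵐ ω ∂μ, 0 ≤ ρ ω := hρ.mono fun ω h => h.nonneg
  set S : Set ℝ := {q | ∀ᵐ ω ∂μ, X ω ≤ q • ρ ω} with hS
  have hdich : ∀ q : ℝ, q ∈ S ∨ ∀ᵐ ω ∂μ, ¬ X ω ≤ q • ρ ω := by
    intro q
    refine Q.ae_or_ae_not
      (X.aestronglyMeasurable.nullMeasurableSet_le (ρ.aestronglyMeasurable.const_smul q)) ?_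
    filter_upwards [hρfix', hfix'] with ω h1 h2 h
    have := (Q.isQuantumChannel (Q.shift ω)).mono h
    rwa [channel_map_real_smul, h1, h2] at this
  have hmono : ∀ {ω : Ω} {a b : ℝ}, 0 ≤ ρ ω → a ≤ b → X ω ≤ a • ρ ω → X ω ≤ b • ρ ω :=
    fun h0 hab h => h.trans (smul_le_smul_of_nonneg_right hab h0)
  -- At a single `ω`, `X` is supported in the range of `ρ`, hence lies below some `Kρ`; not all
  -- integers can fail there.
  have hSne : S.Nonempty := by
    by_contra hcon
    have hall : ∀ n : ℕ, ∀ᵐ ω ∂μ, ¬ X ω ≤ (n : ℝ) • ρ ω := fun n =>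
      (hdich n).resolve_left fun h => hcon ⟨_, h⟩
    obtain ⟨ω, h1, h2, h3, h4, h5⟩ :=
      ((ae_all_iff.mpr hall).and (hρ0.and (hρP.and (hX.and hcorner')))).exists
    obtain ⟨K, -, hK⟩ := exists_le_smul h2 h4 (by rw [h3, h5])
    obtain ⟨n, hn⟩ := exists_nat_ge K
    exact h1 n (hmono h2 hn hK)
  -- Otherwise `tr X ≤ -n` for every `n`, since `tr ρ = 1`.
  have hSbdd : BddBelow S := by
    by_contra hcon
    have hall : ∀ n : ℕ, ∀ᵐ ω ∂μ, X ω ≤ (-(n : ℝ)) • ρ ω := by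
      intro n
      rw [not_bddBelow_iff] at hcon
      obtain ⟨q, hq, hlt⟩ := hcon (-(n : ℝ))
      filter_upwards [hq, hρ0] with ω h1 h2
      exact hmono h2 hlt.le h1
    obtain ⟨ω, h1, h2⟩ := ((ae_all_iff.mpr hall).and hρ).exists
    obtain ⟨n, hn⟩ := exists_nat_gt (-(X ω).trace.re)
    have h3 := trace_re_mono (h1 n)
    rw [Matrix.trace_smul, h2.trace_eq_one] at h3
    simp at h3
    linarith
  set c := sInf S with hc
  have hgt : ∀ n : ℕ, c + 1 / ((n : ℝ) + 1) ∈ S := by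
    intro n
    obtain ⟨q, hq, hlt⟩ := exists_lt_of_csInf_lt hSne
      (show sInf S < c + 1 / ((n : ℝ) + 1) by rw [← hc]; linarith [Nat.one_div_pos_of_nat (α := ℝ) (n := n)])
    filter_upwards [hq, hρ0] with ω h1 h2
    exact hmono h2 hlt.le h1
  have hcS : ∀ᵐ ω ∂μ, X ω ≤ c • ρ ω := by
    filter_upwards [ae_all_iff.mpr hgt] with ω hω
    have hlim : Tendsto (fun n : ℕ => (c + 1 / ((n : ℝ) + 1)) • ρ ω) atTop
        (𝓝 ((c + 0) • ρ ω)) :=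
      (tendsto_const_nhds.add tendsto_one_div_add_atTop_nhds_zero_nat).smul_const _
    rw [add_zero] at hlim
    exact ge_of_tendsto' hlim hω
  have hlt : ∀ n : ℕ, ∀ᵐ ω ∂μ, ¬ X ω ≤ (c - 1 / ((n : ℝ) + 1)) • ρ ω := fun n =>
    (hdich _).resolve_left fun h => by
      have := csInf_le hSbdd h
      rw [← hc] at this
      linarith [Nat.one_div_pos_of_nat (α := ℝ) (n := n)]
  refine ⟨c, ?_⟩
  set Y : RandomMatrix μ d := c • ρ - X with hYdef
  have hY : ∀ᵐ ω ∂μ, Y ω = c • ρ ω - X ω := by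
    filter_upwards [AEEqFun.coeFn_sub (c • ρ) X, AEEqFun.coeFn_smul c ρ] with ω h1 h2
    rw [h1, Pi.sub_apply, h2, Pi.smul_apply]
  have hY0 : ∀ᵐ ω ∂μ, 0 ≤ Y ω := by
    filter_upwards [hY, hcS] with ω h1 h2
    rw [h1]
    exact sub_nonneg.mpr h2
  by_cases hne : Y = 0
  · rw [hne] at hY
    filter_upwards [hY, AEEqFun.coeFn_zero (α := Ω) (β := Mat d) (μ := μ)] with ω h1 h2
    rw [h2, Pi.zero_apply, eq_comm, sub_eq_zero] at h1
    exact h1.symm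
  · exfalso
    have hYfix : Y ∈ Q.fixedPoints := by
      rw [mem_fixedPoints_iff]
      filter_upwards [hY, Q.ae_shift hY, hρfix', hfix'] with ω h1 h2 h3 h4
      rw [h1, h2, map_sub, channel_map_real_smul, h3, h4]
    have hρcorner : ∀ᵐ ω ∂μ, P ω * ρ ω * P ω = ρ ω := by
      filter_upwards [hρ0, hρP] with ω h1 h2
      obtain ⟨hs, h7, -⟩ := rangeProj_spec h1
      have hstar : star (ρ ω) = ρ ω := (Matrix.nonneg_iff_posSemidef.mp h1).1
      have := congrArg star h7
      rw [star_mul, hstar, hs.isSelfAdjoint.star_eq] at this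
      rw [← h2, h7, this]
    have hYcorner : Y ∈ corner P := by
      rw [mem_corner_iff]
      filter_upwards [hY, hρcorner, hcorner'] with ω h1 h2 h3
      rw [h1, mul_sub, sub_mul, mul_smul_comm, smul_mul_assoc, h2, h3]
    have hsupp := rangeProj_eq_of_isMinimalReducing hP hY0 hYfix hYcorner hne
    -- One sample point suffices: `X ≤ (c - 1/(n+1))ρ` fails there for every `n`, while the
    -- domination of `ρ` by `Y` yields it for some `n`.
    obtain ⟨ω, h1, h2, h3, h4, h5, h6⟩ := (hsupp.and (hY0.and (hρ0.and (hρcorner.and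
      (hY.and (ae_all_iff.mpr hlt)))))).exists
    obtain ⟨K, hK, h7⟩ := exists_le_smul h2 (Matrix.nonneg_iff_posSemidef.mp h3).1
      (by rw [h1, h4])
    obtain ⟨n, hn⟩ := exists_nat_ge K
    refine h6 n ?_
    have hn1 : (0 : ℝ) < (n : ℝ) + 1 := by positivity
    have h8 : ρ ω ≤ ((n : ℝ) + 1) • Y ω :=
      h7.trans (smul_le_smul_of_nonneg_right (by linarith) h2)
    have h9 : (1 / ((n : ℝ) + 1)) • ρ ω ≤ Y ω := by
      have := smul_le_smul_of_nonneg_left h8 (one_div_pos.mpr hn1).le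
      rwa [smul_smul, one_div_mul_cancel hn1.ne', one_smul] at this
    rw [h5] at h9
    rw [sub_smul]
    exact le_sub_comm.mp h9

theorem corner_inter_fixedPoints_eq [IsProbabilityMeasure μ] {Q : ERIS μ d}
    {P : RandomMatrix μ d} (hP : Q.IsMinimalReducing P) {ρ : RandomMatrix μ d}
    (hρ : IsRandomState ρ) (hρfix : ρ ∈ Q.fixedPoints) (hρcorner : ρ ∈ corner P)
    (hρP : ∀ᵐ ω ∂μ, rangeProj (ρ ω) = P ω) :
    corner P ∩ Q.fixedPoints = {X | ∃ c : ℂ, X = c • ρ} := by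
  have hρfix' := (mem_fixedPoints_iff Q ρ).mp hρfix
  have hρcorner' := (mem_corner_iff P ρ).mp hρcorner
  ext X
  constructor
  · rintro ⟨hcorner, hfix⟩
    have hfix' := (mem_fixedPoints_iff Q X).mp hfix
    have hcorner' := (mem_corner_iff P X).mp hcorner
    have hherm : ∀ a : ℂ, ∃ c : ℝ, ∀ᵐ ω ∂μ,
        a • X ω + (a • X ω).conjTranspose = c • ρ ω := by
      intro a
      have hm : AEStronglyMeasurable (fun ω => a • X ω + (a • X ω).conjTranspose) μ := by
        have hc : Continuous fun A : Mat d => a • A + (a • A).conjTranspose :=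
          (continuous_const_smul a).add (continuous_const_smul a).matrix_conjTranspose
        exact hc.comp_aestronglyMeasurable X.aestronglyMeasurable
      have hH : ∀ᵐ ω ∂μ, AEEqFun.mk _ hm ω = a • X ω + (a • X ω).conjTranspose :=
        AEEqFun.coeFn_mk _ hm
      have h₁ : ∀ᵐ ω ∂μ, (AEEqFun.mk _ hm ω).IsHermitian := by
        filter_upwards [hH] with ω h1
        rw [h1]
        exact Matrix.isHermitian_add_transpose_self _
      have h₂ : AEEqFun.mk _ hm ∈ Q.fixedPoints := by
        rw [mem_fixedPoints_iff]
        filter_upwards [hH, Q.ae_shift hH, hfix'] with ω h1 h2 h3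
        rw [h1, h2, map_add, (Q.isQuantumChannel _).map_conjTranspose, map_smul, h3]
      have h₃ : AEEqFun.mk _ hm ∈ corner P := by
        rw [mem_corner_iff]
        filter_upwards [hH, hcorner', hP.prop.1.1] with ω h1 h2 h3
        have h4 : P ω * (a • X ω) * P ω = a • X ω := by
          rw [mul_smul_comm, smul_mul_assoc, h2]
        have h5 := congrArg star h4
        rw [star_mul, star_mul, h3.isSelfAdjoint.star_eq, ← mul_assoc,
          Matrix.star_eq_conjTranspose] at h5
        rw [h1, mul_add, add_mul, h4, h5]
      obtain ⟨c, hcρ⟩ := exists_real_of_hermitian hP hρ hρfix hρP h₁ h₂ h₃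
      refine ⟨c, ?_⟩
      filter_upwards [hH, hcρ] with ω h1 h2
      rw [← h1, h2]
    -- The factors `1/2` and `-i/2` produce the real and imaginary parts of `X`.
    obtain ⟨c₁, h₁⟩ := hherm (1 / 2)
    obtain ⟨c₂, h₂⟩ := hherm (-Complex.I / 2)
    refine ⟨c₁ + c₂ * Complex.I, ?_⟩
    rw [AEEqFun.ext_iff]
    filter_upwards [h₁, h₂, AEEqFun.coeFn_smul ((c₁ : ℂ) + c₂ * Complex.I) ρ] with ω h1 h2 h3
    rw [h3, Pi.smul_apply, add_smul, mul_comm, mul_smul, Complex.coe_smul, Complex.coe_smul,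
      ← h1, ← h2]
    ext i j
    simp only [Matrix.add_apply, Matrix.smul_apply, Matrix.conjTranspose_apply, smul_eq_mul,
      star_mul', RCLike.star_def, map_div₀, map_neg, Complex.conj_I, map_one, map_ofNat]
    ring_nf
    simp only [Complex.I_sq]
    ring
  · rintro ⟨c, rfl⟩
    have h := AEEqFun.coeFn_smul c ρ
    constructor
    · rw [mem_corner_iff]
      filter_upwards [h, hρcorner'] with ω h1 h2
      rw [h1, Pi.smul_apply, mul_smul_comm, smul_mul_assoc, h2]
    · rw [mem_fixedPoints_iff]
      filter_upwards [h, Q.ae_shift h, hρfix'] with ω h1 h2 h3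
      rw [h1, h2, Pi.smul_apply, Pi.smul_apply, map_smul, h3]

end Stochastic

/-! ### Closed convex sets in Hilbert space and in `Lp` -/

/-- A decreasing sequence of nonempty bounded closed convex sets in a Hilbert space has a common
point. -/
theorem exists_mem_of_antitone_convex {H : Type*} [NormedAddCommGroup H] [InnerProductSpace ℝ H]
    [CompleteSpace H] {K : ℕ → Set H} (hne : ∀ n, (K n).Nonempty) (hcl : ∀ n, IsClosed (K n))
    (hconv : ∀ n, Convex ℝ (K n)) (hanti : Antitone K) {B : ℝ} (hB : ∀ x ∈ K 0, ‖x‖ ≤ B) :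
    ∃ x, ∀ n, x ∈ K n := by
  -- The points of least norm converge: their norms increase and are bounded, and the parallelogram
  -- law turns this into the Cauchy property.
  have hmin : ∀ n, ∃ v ∈ K n, ∀ w ∈ K n, ‖v‖ ≤ ‖w‖ := by
    intro n
    obtain ⟨v, hv, h⟩ :=
      exists_norm_eq_iInf_of_complete_convex (hne n) (hcl n).isComplete (hconv n) 0
    refine ⟨v, hv, fun w hw => ?_⟩
    simp only [zero_sub, norm_neg] at h
    rw [h]
    exact ciInf_le ⟨0, Set.forall_mem_range.2 fun _ => norm_nonneg _⟩ (⟨w, hw⟩ : K n)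
  choose x hx hxmin using hmin
  have hmono : Monotone fun n => ‖x n‖ ^ 2 := fun n m hnm =>
    pow_le_pow_left₀ (norm_nonneg _) (hxmin n _ (hanti hnm (hx m))) 2
  have hbdd : BddAbove (Set.range fun n => ‖x n‖ ^ 2) := by
    refine ⟨B ^ 2, ?_⟩
    rintro _ ⟨n, rfl⟩
    exact pow_le_pow_left₀ (norm_nonneg _) (hB _ (hanti (Nat.zero_le n) (hx n))) 2
  have hcauchy := (tendsto_atTop_ciSup hmono hbdd).cauchySeq
  have hkey : ∀ n m, n ≤ m → ‖x n - x m‖ ^ 2 ≤ 2 * (‖x m‖ ^ 2 - ‖x n‖ ^ 2) := by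
    intro n m hnm
    have hmid : (2⁻¹ : ℝ) • x n + (2⁻¹ : ℝ) • x m ∈ K n :=
      hconv n (hx n) (hanti hnm (hx m)) (by norm_num) (by norm_num) (by norm_num)
    have h1 := hxmin n _ hmid
    rw [← smul_add, norm_smul, Real.norm_of_nonneg (by norm_num)] at h1
    have h2 := parallelogram_law_with_norm ℝ (x n) (x m)
    nlinarith [norm_nonneg (x n), norm_nonneg (x n + x m)]
  have hxc : CauchySeq x := by
    rw [Metric.cauchySeq_iff'] at hcauchy ⊢
    intro ε hε
    obtain ⟨N, hN⟩ := hcauchy (ε ^ 2 / 2) (by positivity)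
    refine ⟨N, fun n hn => ?_⟩
    have h1 := hN n hn
    rw [Real.dist_eq] at h1
    have h2 := hkey N n hn
    have h3 := (abs_lt.mp h1).2
    rw [dist_comm, dist_eq_norm]
    exact lt_of_pow_lt_pow_left₀ 2 hε.le (by linarith)
  obtain ⟨y, hy⟩ := cauchySeq_tendsto_of_complete hxc
  refine ⟨y, fun n => (hcl n).mem_of_tendsto hy ?_⟩
  filter_upwards [eventually_ge_atTop n] with m hm
  exact hanti hm (hx m)

section Lp

variable {Ω : Type*} [MeasurableSpace Ω] {μ : Measure Ω} {E : Type*} [NormedAddCommGroup E]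
  {p : ENNReal}

/-- A convergent sequence in `Lp` has an almost surely convergent subsequence, and `θ` pulls null
sets back to null sets, so it also converges at `θ ω`. -/
theorem isClosed_setOf_ae_mem [Fact (1 ≤ p)] {θ : Ω → Ω} (hθ : MeasurePreserving θ μ μ)
    {C : Ω → Set (E × E)} (hC : ∀ ω, IsClosed (C ω)) :
    IsClosed {f : Lp E p μ | ∀ᵐ ω ∂μ, (f ω, f (θ ω)) ∈ C ω} := by
  refine IsSeqClosed.isClosed fun f g hf hg => ?_
  obtain ⟨ns, -, hns⟩ := (tendstoInMeasure_of_tendsto_Lp hg).exists_seq_tendsto_ae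
  have hns' := hθ.quasiMeasurePreserving.ae hns
  change ∀ᵐ ω ∂μ, _
  filter_upwards [hns, hns', ae_all_iff.mpr hf] with ω h1 h2 h3
  exact (hC ω).mem_of_tendsto (h1.prodMk_nhds h2) (Eventually.of_forall fun n => h3 (ns n))

theorem convex_setOf_ae_mem [NormedSpace ℝ E] {θ : Ω → Ω} (hθ : MeasurePreserving θ μ μ)
    {C : Ω → Set (E × E)} (hC : ∀ ω, Convex ℝ (C ω)) :
    Convex ℝ {f : Lp E p μ | ∀ᵐ ω ∂μ, (f ω, f (θ ω)) ∈ C ω} := by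
  intro f hf g hg a b ha hb hab
  have h : ⇑(a • f + b • g) =ᵐ[μ] fun ω => a • f ω + b • g ω := by
    filter_upwards [Lp.coeFn_add (a • f) (b • g), Lp.coeFn_smul a f, Lp.coeFn_smul b g]
      with ω h1 h2 h3
    rw [h1, Pi.add_apply, h2, h3, Pi.smul_apply, Pi.smul_apply]
  have h' := hθ.quasiMeasurePreserving.ae h
  change ∀ᵐ ω ∂μ, _
  filter_upwards [h, h', hf, hg] with ω h1 h2 h3 h4
  rw [h1, h2]
  exact hC ω h3 h4 ha hb hab

end Lp

/-! ### Hilbert–Schmidt space and approximate fixed pairs -/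

section Deterministic

variable {d : ℕ}

/-- The continuous linear equivalence of the Hilbert–Schmidt space of `d × d` matrices with the
matrices. -/
noncomputable def hilbertSchmidtEquiv (d : ℕ) :
    EuclideanSpace ℂ (Fin d × Fin d) ≃L[ℝ] Mat d :=
  LinearEquiv.toContinuousLinearEquiv
    { toFun := fun v => Matrix.of fun i j => v (i, j)
      map_add' := fun _ _ => rfl
      map_smul' := fun _ _ => rfl
      invFun := fun A => WithLp.toLp 2 fun p => A p.1 p.2
      left_inv := fun _ => rfl
      right_inv := fun _ => rfl }

theorem hilbertSchmidtEquiv_apply (v : EuclideanSpace ℂ (Fin d × Fin d)) (i j : Fin d) :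
    hilbertSchmidtEquiv d v i j = v (i, j) := rfl

theorem norm_sq_eq_trace (v : EuclideanSpace ℂ (Fin d × Fin d)) :
    ‖v‖ ^ 2 = ((hilbertSchmidtEquiv d v).conjTranspose * hilbertSchmidtEquiv d v).trace.re := by
  rw [EuclideanSpace.norm_sq_eq, Fintype.sum_prod_type, Finset.sum_comm]
  simp only [Matrix.trace, Matrix.diag_apply, Matrix.mul_apply, Matrix.conjTranspose_apply,
    Complex.re_sum, hilbertSchmidtEquiv_apply]
  refine Finset.sum_congr rfl fun j _ => Finset.sum_congr rfl fun i _ => ?_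
  rw [RCLike.star_def, ← Complex.normSq_eq_conj_mul_self, Complex.ofReal_re,
    Complex.normSq_eq_norm_sq]

theorem IsState.norm_le_one {v : EuclideanSpace ℂ (Fin d × Fin d)}
    (h : IsState (hilbertSchmidtEquiv d v)) : ‖v‖ ≤ 1 := by
  have := h.trace_conjTranspose_mul_self_le
  rw [← norm_sq_eq_trace] at this
  exact (sq_le_one_iff₀ (norm_nonneg v)).mp this

/-- The pairs `(A, B)` such that `A` is a state in the corner of `P` whose image under `ψ` is
`ε`-close to `B`. -/
def approxPairs (ψ : Mat d →ₗ[ℂ] Mat d) (P : Mat d) (ε : ℝ) : Set (Mat d × Mat d) :=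
  {p | 0 ≤ p.1 ∧ p.1.trace = 1 ∧ P * p.1 * P = p.1 ∧ ψ p.1 ≤ p.2 + ε • 1 ∧ p.2 ≤ ψ p.1 + ε • 1}

theorem isClosed_approxPairs (ψ : Mat d →ₗ[ℂ] Mat d) (P : Mat d) (ε : ℝ) :
    IsClosed (approxPairs ψ P ε) := by
  have hψ : Continuous ψ := ψ.continuous_of_finiteDimensional
  have hψ₁ : Continuous fun p : Mat d × Mat d => ψ p.1 := hψ.comp continuous_fst
  have hcorner : IsClosed {p : Mat d × Mat d | P * p.1 * P = p.1} :=
    isClosed_eq (by fun_prop) continuous_fst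
  have hle : IsClosed {p : Mat d × Mat d | ψ p.1 ≤ p.2 + ε • 1} :=
    isClosed_le hψ₁ (continuous_snd.add continuous_const)
  have hge : IsClosed {p : Mat d × Mat d | p.2 ≤ ψ p.1 + ε • 1} :=
    isClosed_le continuous_snd (hψ₁.add continuous_const)
  exact (isClosed_le continuous_const continuous_fst).inter
    ((isClosed_eq continuous_fst.matrix_trace continuous_const).inter
    (hcorner.inter (hle.inter hge)))

theorem convex_approxPairs (ψ : Mat d →ₗ[ℂ] Mat d) (P : Mat d) (ε : ℝ) :
    Convex ℝ (approxPairs ψ P ε) := by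
  rintro ⟨A, B⟩ ⟨h1, h2, h3, h4, h5⟩ ⟨A', B'⟩ ⟨h1', h2', h3', h4', h5'⟩ a b ha hb hab
  simp only at *
  have hε : ε • (1 : Mat d) = a • ε • 1 + b • ε • 1 := by rw [← add_smul, hab, one_smul]
  refine ⟨add_nonneg (smul_nonneg ha h1) (smul_nonneg hb h1'), ?_, ?_, ?_, ?_⟩
  · simp only [Prod.smul_mk, Prod.mk_add_mk, Matrix.trace_add, Matrix.trace_smul, h2, h2']
    rw [← add_smul, hab, one_smul]
  · simp only [Prod.smul_mk, Prod.mk_add_mk, mul_add, add_mul, mul_smul_comm, smul_mul_assoc, h3,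
      h3']
  · simp only [Prod.smul_mk, Prod.mk_add_mk, map_add, channel_map_real_smul]
    rw [hε]
    have := add_le_add (smul_le_smul_of_nonneg_left h4 ha) (smul_le_smul_of_nonneg_left h4' hb)
    rw [smul_add, smul_add] at this
    exact this.trans_eq (by abel)
  · simp only [Prod.smul_mk, Prod.mk_add_mk, map_add, channel_map_real_smul]
    rw [hε]
    have := add_le_add (smul_le_smul_of_nonneg_left h5 ha) (smul_le_smul_of_nonneg_left h5' hb)
    rw [smul_add, smul_add] at this
    exact this.trans_eq (by abel)

theorem approxPairs_mono (ψ : Mat d →ₗ[ℂ] Mat d) (P : Mat d) {ε δ : ℝ} (h : ε ≤ δ) :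
    approxPairs ψ P ε ⊆ approxPairs ψ P δ := by
  rintro p ⟨h1, h2, h3, h4, h5⟩
  have h6 : ε • (1 : Mat d) ≤ δ • 1 := smul_le_smul_of_nonneg_right h zero_le_one
  exact ⟨h1, h2, h3, h4.trans (add_le_add_right h6 _), h5.trans (add_le_add_right h6 _)⟩

end Deterministic

/-! ### Cesàro averages and the stationary state -/

section Stochastic

variable {Ω : Type*} [MeasurableSpace Ω] {μ : Measure Ω} {d : ℕ}

/-- The orbit of a random matrix under `𝔏`, as a sequence of functions. -/
def orbit (Q : ERIS μ d) (x : Ω → Mat d) : ℕ → Ω → Mat d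
  | 0, ω => x ω
  | n + 1, ω => Q.channel ω (orbit Q x n (Q.shift.symm ω))

theorem orbit_succ_shift (Q : ERIS μ d) (x : Ω → Mat d) (n : ℕ) (ω : Ω) :
    Q.orbit x (n + 1) (Q.shift ω) = Q.channel (Q.shift ω) (Q.orbit x n ω) := by
  simp [orbit]

theorem aestronglyMeasurable_orbit (Q : ERIS μ d) {x : Ω → Mat d}
    (hx : AEStronglyMeasurable x μ) (n : ℕ) : AEStronglyMeasurable (Q.orbit x n) μ := by
  induction n with
  | zero => exact hx
  | succ n ih =>
    exact Q.aestronglyMeasurable_channel_apply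
      (ih.comp_measurePreserving Q.measurePreserving_symm)

theorem isState_orbit (Q : ERIS μ d) {x : Ω → Mat d} (hx : ∀ᵐ ω ∂μ, IsState (x ω)) (n : ℕ) :
    ∀ᵐ ω ∂μ, IsState (Q.orbit x n ω) := by
  induction n with
  | zero => exact hx
  | succ n ih =>
    filter_upwards [Q.ae_shift_symm ih] with ω h
    exact (Q.isQuantumChannel ω).isState h

theorem corner_orbit {Q : ERIS μ d} {P : RandomMatrix μ d} (hP : Q.Reduces P) {x : Ω → Mat d}
    (hx : ∀ᵐ ω ∂μ, IsState (x ω)) (hxP : ∀ᵐ ω ∂μ, P ω * x ω * P ω = x ω) (n : ℕ) :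
    ∀ᵐ ω ∂μ, P ω * Q.orbit x n ω * P ω = Q.orbit x n ω := by
  induction n with
  | zero => exact hxP
  | succ n ih =>
    -- The reduction is a statement from `ω` to `θω`, so the induction step is proved at `θω` and
    -- pulled back.
    have h : ∀ᵐ ω ∂μ, P (Q.shift ω) * Q.orbit x (n + 1) (Q.shift ω) * P (Q.shift ω) =
        Q.orbit x (n + 1) (Q.shift ω) := by
      filter_upwards [ih, hP.1, Q.ae_shift hP.1, hP.step, Q.isState_orbit hx n]
        with ω h1 h2 h3 ⟨K, _, h4⟩ h5
      rw [orbit_succ_shift]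
      exact (Q.isQuantumChannel _).map_corner h2 h3 h4 h5.nonneg h1
    filter_upwards [Q.ae_shift_symm h] with ω hω
    simpa only [MeasurableEquiv.apply_symm_apply] using hω

/-- The Cesàro averages of the orbit of a random matrix under `𝔏`. -/
noncomputable def average (Q : ERIS μ d) (x : Ω → Mat d) (N : ℕ) (ω : Ω) : Mat d :=
  (1 / ((N : ℝ) + 1)) • ∑ n ∈ Finset.range (N + 1), Q.orbit x n ω

/-- The sums telescope, leaving the first and last orbit terms over `N + 1`; both are states, so
they lie between `0` and `1`. -/
theorem average_mem_approxPairs {Q : ERIS μ d} {P : RandomMatrix μ d} (hP : Q.Reduces P)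
    {x : Ω → Mat d} (hx : ∀ᵐ ω ∂μ, IsState (x ω)) (hxP : ∀ᵐ ω ∂μ, P ω * x ω * P ω = x ω)
    (N : ℕ) : ∀ᵐ ω ∂μ, (Q.average x N ω, Q.average x N (Q.shift ω)) ∈
      approxPairs (Q.channel (Q.shift ω)) (P ω) (1 / ((N : ℝ) + 1)) := by
  have hN : (0 : ℝ) < (N : ℝ) + 1 := by positivity
  have hst := ae_all_iff.mpr (Q.isState_orbit hx)
  filter_upwards [hst, Q.ae_shift hst, ae_all_iff.mpr (corner_orbit hP hx hxP)] with ω h1 h2 h3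
  have h4 : Q.channel (Q.shift ω) (Q.average x N ω) +
      (1 / ((N : ℝ) + 1)) • Q.orbit x 0 (Q.shift ω) =
      Q.average x N (Q.shift ω) + (1 / ((N : ℝ) + 1)) • Q.orbit x (N + 1) (Q.shift ω) := by
    simp only [average]
    rw [channel_map_real_smul, map_sum, ← smul_add, ← smul_add, ← Finset.sum_range_succ,
      Finset.sum_range_succ' _ (N + 1)]
    simp only [orbit_succ_shift]
  have hpos : (0 : ℝ) ≤ 1 / ((N : ℝ) + 1) := (one_div_pos.mpr hN).le
  refine ⟨smul_nonneg hpos (Finset.sum_nonneg fun n _ => (h1 n).nonneg), ?_, ?_, ?_, ?_⟩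
  · simp only [average, Matrix.trace_smul, Matrix.trace_sum, (h1 _).trace_eq_one,
      Finset.sum_const, Finset.card_range, nsmul_eq_mul, mul_one, Complex.real_smul]
    push_cast
    rw [one_div_mul_cancel]
    exact_mod_cast hN.ne'
  · simp only [average, mul_smul_comm, smul_mul_assoc, Finset.mul_sum, Finset.sum_mul, h3]
  · calc _ ≤ Q.channel (Q.shift ω) (Q.average x N ω) +
          (1 / ((N : ℝ) + 1)) • Q.orbit x 0 (Q.shift ω) :=
        le_add_of_nonneg_right (smul_nonneg hpos (h2 0).nonneg)
      _ ≤ _ := by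
        rw [h4]
        exact add_le_add_right (smul_le_smul_of_nonneg_left (h2 _).le_one hpos) _
  · calc _ ≤ Q.average x N (Q.shift ω) +
          (1 / ((N : ℝ) + 1)) • Q.orbit x (N + 1) (Q.shift ω) :=
        le_add_of_nonneg_right (smul_nonneg hpos (h2 _).nonneg)
      _ ≤ _ := by
        rw [← h4]
        exact add_le_add_right (smul_le_smul_of_nonneg_left (h2 _).le_one hpos) _

/-- The corner of a nonzero reducing projection contains a random state. -/
theorem exists_state_mem_corner [IsProbabilityMeasure μ] {Q : ERIS μ d} {P : RandomMatrix μ d}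
    (hP : Q.Reduces P) (hne : P ≠ 0) : ∃ x : Ω → Mat d, AEStronglyMeasurable x μ ∧
      (∀ᵐ ω ∂μ, IsState (x ω)) ∧ ∀ᵐ ω ∂μ, P ω * x ω * P ω = x ω := by
  refine ⟨fun ω => (P ω).trace.re⁻¹ • P ω, ?_, ?_, ?_⟩
  · have hc : Continuous fun A : Mat d => A.trace.re := by fun_prop
    exact (hc.comp_aestronglyMeasurable P.aestronglyMeasurable).inv₀.smul P.aestronglyMeasurable
  · filter_upwards [hP.1, hP.ae_ne_zero hne] with ω h1 h2
    have h3 := Matrix.nonneg_iff_posSemidef.mp h1.nonneg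
    have h4 : (P ω).trace = ((P ω).trace.re : ℂ) := by
      have := (Complex.nonneg_iff.mp h3.trace_nonneg).2
      apply Complex.ext <;> simp [← this]
    have h5 : (P ω).trace.re ≠ 0 := fun h => h2 (h3.trace_eq_zero_iff.mp (by rw [h4, h]; rfl))
    refine ⟨Matrix.nonneg_iff_posSemidef.mp
      (smul_nonneg (inv_nonneg.mpr (trace_re_nonneg h1.nonneg)) h1.nonneg), ?_⟩
    rw [Matrix.trace_smul, Complex.real_smul]
    nth_rewrite 2 [h4]
    rw [← Complex.ofReal_mul, inv_mul_cancel₀ h5, Complex.ofReal_one]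
  · filter_upwards [hP.1] with ω h1
    rw [mul_smul_comm, smul_mul_assoc, h1.isIdempotentElem.eq, h1.isIdempotentElem.eq]

/-- The corner of a nonzero reducing projection contains a random state that `𝔏` fixes. -/
theorem exists_stationary_state [IsProbabilityMeasure μ] {Q : ERIS μ d} {P : RandomMatrix μ d}
    (hP : Q.Reduces P) (hne : P ≠ 0) :
    ∃ ρ : RandomMatrix μ d, IsRandomState ρ ∧ ρ ∈ corner P ∧ ρ ∈ Q.fixedPoints := by
  obtain ⟨x, hxm, hx, hxP⟩ := exists_state_mem_corner hP hne
  set e := hilbertSchmidtEquiv d with he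
  set C : ℕ → Ω → Set (EuclideanSpace ℂ (Fin d × Fin d) × EuclideanSpace ℂ (Fin d × Fin d)) :=
    fun n ω => Prod.map e e ⁻¹'
      approxPairs (Q.channel (Q.shift ω)) (P ω) (1 / ((n : ℝ) + 1)) with hCdef
  have hCcl : ∀ n ω, IsClosed (C n ω) := fun n ω =>
    (isClosed_approxPairs _ _ _).preimage (e.continuous.prodMap e.continuous)
  have hCconv : ∀ n ω, Convex ℝ (C n ω) := fun n ω =>
    (convex_approxPairs _ _ _).linear_preimage
      ((e : EuclideanSpace ℂ (Fin d × Fin d) →ₗ[ℝ] Mat d).prodMap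
        (e : EuclideanSpace ℂ (Fin d × Fin d) →ₗ[ℝ] Mat d))
  have hθ := Q.ergodic.toMeasurePreserving
  -- States have Hilbert–Schmidt norm at most `1`, so these sets are bounded in `L²`.
  set K : ℕ → Set (Lp (EuclideanSpace ℂ (Fin d × Fin d)) 2 μ) :=
    fun n => {f | ∀ᵐ ω ∂μ, (f ω, f (Q.shift ω)) ∈ C n ω} with hK
  have hstate : ∀ {n ω v w}, (v, w) ∈ C n ω → IsState (e v) := fun h =>
    ⟨Matrix.nonneg_iff_posSemidef.mp h.1, h.2.1⟩
  have hKne : ∀ n, (K n).Nonempty := by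
    intro n
    have hm : AEStronglyMeasurable (fun ω => e.symm (Q.average x n ω)) μ := by
      refine e.symm.continuous.comp_aestronglyMeasurable ?_
      exact (Finset.aestronglyMeasurable_fun_sum _
        fun k _ => Q.aestronglyMeasurable_orbit hxm k).const_smul (1 / ((n : ℝ) + 1))
    have hmem : ∀ᵐ ω ∂μ, (e.symm (Q.average x n ω), e.symm (Q.average x n (Q.shift ω))) ∈
        C n ω := by
      filter_upwards [average_mem_approxPairs hP hx hxP n] with ω hω
      simpa [hCdef] using hω
    have hLp : MemLp (fun ω => e.symm (Q.average x n ω)) 2 μ :=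
      MemLp.of_bound hm 1 (hmem.mono fun ω hω => (hstate hω).norm_le_one)
    refine ⟨hLp.toLp _, ?_⟩
    change ∀ᵐ ω ∂μ, _
    filter_upwards [hmem, hLp.coeFn_toLp, Q.ae_shift hLp.coeFn_toLp] with ω h1 h2 h3
    rw [h2, h3]
    exact h1
  have hanti : Antitone K := fun n m hnm f (hf : ∀ᵐ ω ∂μ, _) => hf.mono fun ω hω =>
    approxPairs_mono _ _ (Nat.one_div_le_one_div hnm) hω
  obtain ⟨f, hf⟩ := exists_mem_of_antitone_convex hKne
    (fun n => isClosed_setOf_ae_mem hθ (hCcl n)) (fun n => convex_setOf_ae_mem hθ (hCconv n)) hanti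
    (B := measureUnivNNReal μ ^ (2 : ENNReal).toReal⁻¹ * 1)
    (fun f (hf : ∀ᵐ ω ∂μ, _) => Lp.norm_le_of_ae_bound zero_le_one
      (hf.mono fun ω hω => (hstate hω).norm_le_one))
  have hf' : ∀ᵐ ω ∂μ, ∀ n, (f ω, f (Q.shift ω)) ∈ C n ω := ae_all_iff.mpr hf
  have hm : AEStronglyMeasurable (fun ω => e (f ω)) μ :=
    e.continuous.comp_aestronglyMeasurable (Lp.aestronglyMeasurable f)
  have hρ : ∀ᵐ ω ∂μ, AEEqFun.mk _ hm ω = e (f ω) := AEEqFun.coeFn_mk _ hm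
  refine ⟨AEEqFun.mk _ hm, ?_, ?_, ?_⟩
  · filter_upwards [hρ, hf'] with ω h1 h2
    rw [h1]
    exact hstate (h2 0)
  · rw [mem_corner_iff]
    filter_upwards [hρ, hf'] with ω h1 h2
    rw [h1]
    exact (h2 0).2.2.1
  · rw [mem_fixedPoints_iff]
    filter_upwards [hρ, Q.ae_shift hρ, hf'] with ω h1 h2 h3
    rw [h1, h2]
    -- At a fixed `ω` both Loewner bounds hold for all `n`; letting the error tend to `0` gives
    -- equality.
    have hlim : ∀ A : Mat d, Tendsto (fun n : ℕ => A + (1 / ((n : ℝ) + 1)) • (1 : Mat d)) atTop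
        (𝓝 A) := by
      intro A
      have := (tendsto_one_div_add_atTop_nhds_zero_nat (𝕜 := ℝ)).smul_const (1 : Mat d)
      simpa using this.const_add A
    exact le_antisymm (ge_of_tendsto' (hlim _) fun n => (h3 n).2.2.2.1)
      (ge_of_tendsto' (hlim _) fun n => (h3 n).2.2.2.2)

end Stochastic

end ERIS

theorem mainTheorem6 {Ω : Type*} [MeasurableSpace Ω] (μ : MeasureTheory.Measure Ω)
    [MeasureTheory.IsProbabilityMeasure μ] (d : ℕ) (Q : ERIS μ d)
    (P : ERIS.RandomMatrix μ d) (hP : Q.IsMinimalReducing P) :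
    ∃ ρ : ERIS.RandomMatrix μ d,
      ERIS.IsRandomState ρ ∧
      ρ ∈ ERIS.cornerL1 P ∧
      (∀ᵐ ω ∂μ, ERIS.rangeProj (ρ ω) = P ω) ∧
      ERIS.corner P ∩ Q.fixedPoints = {X | ∃ c : ℂ, X = c • ρ} := by
  obtain ⟨ρ, hρ, hcorner, hfix⟩ := ERIS.exists_stationary_state hP.prop.1 hP.prop.2
  have hρne : ρ ≠ 0 := ERIS.ne_zero_of_ae_ne_zero (hρ.mono fun ω h h0 => by
    have := h.trace_eq_one
    simp [h0] at this)
  have hsupp := ERIS.rangeProj_eq_of_isMinimalReducing hP (hρ.mono fun ω h => h.nonneg) hfix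
    hcorner hρne
  refine ⟨ρ, hρ, ⟨hcorner, ?_⟩, hsupp,
    ERIS.corner_inter_fixedPoints_eq hP hρ hfix hcorner hsupp⟩
  -- The crude bound `tr |ρ| ≤ d` is enough for integrability.
  calc _ ≤ ∫⁻ _ω, ENNReal.ofReal d ∂μ :=
        lintegral_mono_ae (hρ.mono fun ω h => ENNReal.ofReal_le_ofReal h.traceNorm_le)
    _ < ⊤ := by simp
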